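/- Let $G$ be a connected (finite-dimensional, real) solvable Lie group with identity $e$ and Lie algebra $\mathfrak g=T_eG$. A flow of automorphisms of $G$ is a one-parameter subgroup $\varphi=\{\varphi_t\}_{t\in\mathbb R}$ of the group $\mathrm{Aut}(G)$ of Lie group automorphisms of $G$, i.e. $\varphi_{s+t}=\varphi_s\circ\varphi_t$, $\varphi_0=\mathrm{id}$, each $\varphi_t$ is a smooth automorphism and $(t,g)\mapsto\varphi_t(g)$ is continuous; $\varphi$ is nilpotent if the linear map $\mathcal D:\mathfrak g\to\mathfrak g$ determined by $(d\varphi_t)_e=e^{t\mathcal D}$ for all $t\in\mathbb R$ is nilpotent. For a neighborhood $U$ of $e$ and $\tau>0$, a $(U,\tau)$-chain from $x$ to $y$ consists of an integer $n\ge 1$, points $x=x_0,x_1,\ldots,x_n=y$ of $G$ and times $\tau_0,\ldots,\tau_{n-1}\ge\tau$ such that $x_{i+1}^{-1}\varphi_{\tau_i}(x_i)\in U$ for $i=0,\ldots,n-1$. Let $\Omega(x)$ be the set of all $y\in G$ such that for every neighborhood $U$ of $e$ and every $\tau>0$ there is a $(U,\tau)$-chain from $x$ to $y$, and let $\mathcal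 R_C(\varphi)=\{x\in G: x\in\Omega(x)\}$. On $\mathcal R_C(\varphi)$ put $x\sim y$ if and only if $x\in\Omega(y)$ and $y\in\Omega(x)$. The flow $\varphi$ is chain transitive if $G$ is contained in a single equivalence class of $\sim$. Then every nilpotent flow of automorphisms $\varphi$ on $G$ is chain transitive. -/

import Mathlib

open scoped Manifold ContDiff Topology

noncomputable section

variable {E : Type*} [NormedAddCommGroup E] [NormedSpace ℝ E]
  {H : Type*} [TopologicalSpace H] (I : ModelWithCorners ℝ E H)
  (G : Type*) [TopologicalSpace G] [ChartedSpace H G] [Group G]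

/-- A flow of automorphisms of the Lie group `G`: a one-parameter subgroup `t ↦ φ_t`, `t ∈ ℝ`, of
the group of Lie group automorphisms of `G`. Each `φ_t` is a smooth group homomorphism (with smooth
inverse `φ_{-t}`), and continuity of the one-parameter subgroup is continuity of
`(t, g) ↦ φ_t g` on `ℝ × G`, which is part of `Flow ℝ G`. -/
structure AutomorphismFlow extends Flow ℝ G where
  map_mul' : ∀ (t : ℝ) (g h : G), toFun t (g * h) = toFun t g * toFun t h
  contMDiff' : ∀ t : ℝ, ContMDiff I I ∞ (toFun t)

namespace AutomorphismFlow

variable {I G}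

instance : CoeFun (AutomorphismFlow I G) fun _ => ℝ → G → G := ⟨fun φ => φ.toFun⟩

/-- The differential `(dφ_t)_e` as an endomorphism of the Lie algebra `T_e G`. Its codomain is a
priori `T_{φ_t e} G`, which is `T_e G` since `φ_t e = e`. In Mathlib, `TangentSpace I g` is by
definition the model space `E`, read in the preferred chart at `g`; the Lie algebra of `G` is
written as `E` here because `TangentSpace` carries no norm. -/
def differentialAtOne (φ : AutomorphismFlow I G) (t : ℝ) : E →L[ℝ] E :=
  mfderiv I I (φ t) (1 : G)

/-- `D` is the infinitesimal generator of `φ` on the Lie algebra `T_e G = E`: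
`(dφ_t)_e = e^{tD}` for all `t`. Such a `D` is unique, and it is automatically a derivation. -/
def IsAssociatedDerivation (φ : AutomorphismFlow I G) (D : E →L[ℝ] E) : Prop :=
  ∀ t : ℝ, φ.differentialAtOne t = NormedSpace.exp (t • D)

/-- A flow of automorphisms is nilpotent if its associated derivation is nilpotent. -/
def IsNilpotentFlow (φ : AutomorphismFlow I G) : Prop :=
  ∃ D : E →L[ℝ] E, φ.IsAssociatedDerivation D ∧ IsNilpotent D

/-- There is a `(U, τ)`-chain from `x` to `y`: a number `n ≥ 1` of jumps, points `x_0, …, x_n` and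
times `τ_0, …, τ_{n-1} ≥ τ` with `x_0 = x`, `x_n = y` and `x_{i+1}⁻¹ φ_{τ_i}(x_i) ∈ U`. -/
def ExistsChain (φ : AutomorphismFlow I G) (U : Set G) (τ : ℝ) (x y : G) : Prop :=
  ∃ (n : ℕ) (p : ℕ → G) (T : ℕ → ℝ), 1 ≤ n ∧ p 0 = x ∧ p n = y ∧
    ∀ i < n, τ ≤ T i ∧ (p (i + 1))⁻¹ * φ (T i) (p i) ∈ U

/-- The chain limit set `Ω(x)`. -/
def chainLimitSet (φ : AutomorphismFlow I G) (x : G) : Set G :=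
  {y | ∀ U ∈ 𝓝 (1 : G), ∀ τ : ℝ, 0 < τ → φ.ExistsChain U τ x y}

/-- The chain recurrent set. -/
def chainRecurrentSet (φ : AutomorphismFlow I G) : Set G :=
  {x | x ∈ φ.chainLimitSet x}

/-- The chain transitive component of `x` (for `x` chain recurrent): the class of `x` under
`x ∼ y ↔ x ∈ Ω(y) ∧ y ∈ Ω(x)` on the chain recurrent set. -/
def chainComponent (φ : AutomorphismFlow I G) (x : G) : Set G :=
  {y | y ∈ φ.chainRecurrentSet ∧ x ∈ φ.chainLimitSet y ∧ y ∈ φ.chainLimitSet x}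

/-- A set is chain transitive if it is contained in a chain transitive component. -/
def IsChainTransitiveSet (φ : AutomorphismFlow I G) (F : Set G) : Prop :=
  ∃ x ∈ φ.chainRecurrentSet, F ⊆ φ.chainComponent x

/-- The flow is chain transitive if the whole group is a chain transitive set. -/
def IsChainTransitive (φ : AutomorphismFlow I G) : Prop :=
  φ.IsChainTransitiveSet Set.univ

end AutomorphismFlow

end

/-!
Let `(dφ_t)_e = e^{tD}` with `D ^ m = 0`. Since `e^{qD}` is unipotent, `1` is a linear combination
`∑_{k=1}^m c_k e^{kqD}` whose coefficients do not depend on `q`. Hence, whenever multiplication is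
additive on exponentials modulo a normal subgroup `B`, `exp X` is congruent modulo `B` to a product
of the elements `φ_{kq}(exp (c_k X))`; replacing `X` by `X / n`, the arguments of `φ_{kq}` are as
close to `e` as we like, while `q` remains free. Applying this to consecutive terms `A ⊇ B` of the
closed derived series and inducting from the trivial subgroup upwards, every element of `G` is a
product `φ_{S₁}(u₁) ⋯ φ_{Sₙ}(uₙ)` with `uᵢ` close to `e` and `Sᵢ` large and far apart. Such a
product is reached from `e` by a chain with jumps `uᵢ`. Applied to the reversed flow, which is also
nilpotent, the same statement yields a chain from every element back to `e`.
-/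

section DerivativeAtOne

variable {E : Type*} [NormedAddCommGroup E] [NormedSpace ℝ E]
  {H : Type*} [TopologicalSpace H] {I : ModelWithCorners ℝ E H}
  {G : Type*} [TopologicalSpace G] [ChartedSpace H G] [Group G]
  {W : Type*} [NormedAddCommGroup W] [NormedSpace ℝ W]

/-- `a w = 1`, and `a`, read in the preferred chart at the identity, has strict derivative `A` at
`w`. -/
structure HasStrictFDerivAtOne (I : ModelWithCorners ℝ E H) (a : W → G) (A : W →L[ℝ] E)
    (w : W) : Prop where
  map_eq_one : a w = 1
  continuousAt : ContinuousAt a w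
  hasStrictFDerivAt : HasStrictFDerivAt (fun x ↦ extChartAt I (1 : G) (a x)) A w

/-- The curve `γ` passes through the identity at time `0` with velocity `X`. -/
abbrev HasVelocity (I : ModelWithCorners ℝ E H) (γ : ℝ → G) (X : E) : Prop :=
  HasStrictFDerivAtOne I γ (ContinuousLinearMap.toSpanSingleton ℝ X) 0

/-- The multiplication of `G`, read in the preferred chart at the identity. -/
noncomputable def chartMul (I : ModelWithCorners ℝ E H) (G : Type*) [TopologicalSpace G]
    [ChartedSpace H G] [Group G] (p : E × E) : E :=
  extChartAt I (1 : G) ((extChartAt I (1 : G)).symm p.1 * (extChartAt I (1 : G)).symm p.2)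

/-- The derivative at the identity of a map fixing the identity, as a linear map between the model
spaces of the tangent spaces. -/
noncomputable def derivAtOne (I : ModelWithCorners ℝ E H)
    {E' : Type*} [NormedAddCommGroup E'] [NormedSpace ℝ E']
    {H' : Type*} [TopologicalSpace H'] (I' : ModelWithCorners ℝ E' H')
    {G' : Type*} [TopologicalSpace G'] [ChartedSpace H' G']
    (f : G → G') : E →L[ℝ] E' :=
  mfderiv I I' f (1 : G)

theorem HasStrictFDerivAtOne.comp {V : Type*} [NormedAddCommGroup V] [NormedSpace ℝ V]
    {a : W → G} {A : W →L[ℝ] E} {f : V → W} {F : V →L[ℝ] W} {v : V}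
    (ha : HasStrictFDerivAtOne I a A (f v)) (hf : HasStrictFDerivAt f F v) :
    HasStrictFDerivAtOne I (fun x ↦ a (f x)) (A ∘L F) v where
  map_eq_one := ha.map_eq_one
  continuousAt := ha.continuousAt.comp hf.continuousAt
  hasStrictFDerivAt := ha.hasStrictFDerivAt.comp v hf

theorem HasStrictFDerivAtOne.one (w : W) : HasStrictFDerivAtOne I (fun _ : W ↦ (1 : G)) 0 w :=
  ⟨rfl, continuousAt_const, hasStrictFDerivAt_const _ _⟩

theorem HasVelocity.comp_const_mul {γ : ℝ → G} {X : E} (h : HasVelocity I γ X) (c : ℝ) :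
    HasVelocity I (fun t ↦ γ (c * t)) (c • X) := by
  have hc : HasStrictFDerivAt (fun t : ℝ ↦ c * t) (c • ContinuousLinearMap.id ℝ ℝ) 0 :=
    (hasStrictFDerivAt_id 0).const_mul c
  convert HasStrictFDerivAtOne.comp (f := fun t ↦ c * t) (by rwa [mul_zero]) hc using 1
  ext; simp

variable [I.Boundaryless]

theorem contMDiffAt_extChartAt_symm_one {n : ℕ∞ω} [IsManifold I n G] :
    ContMDiffAt 𝓘(ℝ, E) I n (extChartAt I (1 : G)).symm (extChartAt I (1 : G) 1) :=
  (contMDiffOn_extChartAt_symm (1 : G)).contMDiffAt (extChartAt_target_mem_nhds (1 : G))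

theorem hasStrictFDerivAt_derivAtOne [IsManifold I 1 G]
    {E' : Type*} [NormedAddCommGroup E'] [NormedSpace ℝ E']
    {H' : Type*} [TopologicalSpace H'] {I' : ModelWithCorners ℝ E' H'}
    {G' : Type*} [TopologicalSpace G'] [ChartedSpace H' G'] [Group G'] [IsManifold I' 1 G']
    {f : G → G'} (hf : ContMDiffAt I I' 1 f 1) (hf1 : f 1 = 1) :
    HasStrictFDerivAt (fun x ↦ extChartAt I' (1 : G') (f ((extChartAt I (1 : G)).symm x)))
      (derivAtOne I I' f) (extChartAt I (1 : G) 1) := by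
  have hsmooth : ContDiffAt ℝ 1
      (fun x ↦ extChartAt I' (1 : G') (f ((extChartAt I (1 : G)).symm x)))
      (extChartAt I (1 : G) 1) := by
    rw [← contMDiffAt_iff_contDiffAt]
    refine ContMDiffAt.comp (I' := I') (g := extChartAt I' (1 : G')) _ ?_
      (ContMDiffAt.comp (I' := I) (g := f) _ ?_ contMDiffAt_extChartAt_symm_one)
    · simpa only [extChartAt_to_inv, hf1] using contMDiffAt_extChartAt
    · simpa only [extChartAt_to_inv] using hf
  have hderiv := (hf.mdifferentiableAt one_ne_zero).hasMFDerivAt.2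
  simp only [writtenInExtChartAt, I.range_eq_univ, hf1] at hderiv
  exact hsmooth.hasStrictFDerivAt' (hasFDerivWithinAt_univ.1 hderiv) one_ne_zero

theorem HasStrictFDerivAtOne.map [IsManifold I 1 G]
    {E' : Type*} [NormedAddCommGroup E'] [NormedSpace ℝ E']
    {H' : Type*} [TopologicalSpace H'] {I' : ModelWithCorners ℝ E' H'}
    {G' : Type*} [TopologicalSpace G'] [ChartedSpace H' G'] [Group G'] [IsManifold I' 1 G']
    {f : G → G'} {a : W → G} {A : W →L[ℝ] E} {w : W}
    (ha : HasStrictFDerivAtOne I a A w) (hf : ContMDiffAt I I' 1 f 1) (hf1 : f 1 = 1) :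
    HasStrictFDerivAtOne I' (fun x ↦ f (a x)) (derivAtOne I I' f ∘L A) w where
  map_eq_one := by rw [ha.map_eq_one, hf1]
  continuousAt := ContinuousAt.comp (g := f) (by rw [ha.map_eq_one]; exact hf.continuousAt)
    ha.continuousAt
  hasStrictFDerivAt := by
    have hchart := hasStrictFDerivAt_derivAtOne hf hf1
    rw [← congrArg (extChartAt I (1 : G)) ha.map_eq_one] at hchart
    refine (hchart.comp w ha.hasStrictFDerivAt).congr_of_eventuallyEq ?_
    filter_upwards [ha.continuousAt.preimage_mem_nhds
      (by rw [ha.map_eq_one]; exact extChartAt_source_mem_nhds (I := I) (1 : G))] with x hx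
    exact congrArg (fun g ↦ extChartAt I' (1 : G') (f g)) ((extChartAt I (1 : G)).left_inv hx)

theorem HasVelocity.map [IsManifold I 1 G]
    {E' : Type*} [NormedAddCommGroup E'] [NormedSpace ℝ E']
    {H' : Type*} [TopologicalSpace H'] {I' : ModelWithCorners ℝ E' H'}
    {G' : Type*} [TopologicalSpace G'] [ChartedSpace H' G'] [Group G'] [IsManifold I' 1 G']
    {f : G → G'} {γ : ℝ → G} {X : E}
    (h : HasVelocity I γ X) (hf : ContMDiffAt I I' 1 f 1) (hf1 : f 1 = 1) :
    HasVelocity I' (fun t ↦ f (γ t)) (derivAtOne I I' f X) := by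
  simpa only [HasVelocity, ContinuousLinearMap.comp_toSpanSingleton] using
    HasStrictFDerivAtOne.map h hf hf1

variable [LieGroup I 1 G]

theorem contDiffAt_chartMul :
    ContDiffAt ℝ 1 (chartMul I G) (extChartAt I (1 : G) 1, extChartAt I (1 : G) 1) := by
  rw [← contMDiffAt_iff_contDiffAt]
  have hfst : ContMDiffAt 𝓘(ℝ, E × E) I 1 (fun p : E × E ↦ (extChartAt I (1 : G)).symm p.1)
      (extChartAt I (1 : G) 1, extChartAt I (1 : G) 1) :=
    ContMDiffAt.comp (I' := 𝓘(ℝ, E)) _ contMDiffAt_extChartAt_symm_one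
      contDiff_fst.contMDiff.contMDiffAt
  have hsnd : ContMDiffAt 𝓘(ℝ, E × E) I 1 (fun p : E × E ↦ (extChartAt I (1 : G)).symm p.2)
      (extChartAt I (1 : G) 1, extChartAt I (1 : G) 1) :=
    ContMDiffAt.comp (I' := 𝓘(ℝ, E)) _ contMDiffAt_extChartAt_symm_one
      contDiff_snd.contMDiff.contMDiffAt
  refine ContMDiffAt.comp (I' := I) (g := extChartAt I (1 : G)) _ ?_ (hfst.mul hsnd)
  simpa only [extChartAt_to_inv, mul_one] using contMDiffAt_extChartAt

theorem hasStrictFDerivAt_chartMul :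
    HasStrictFDerivAt (chartMul I G)
      (ContinuousLinearMap.fst ℝ E E + ContinuousLinearMap.snd ℝ E E)
      (extChartAt I (1 : G) 1, extChartAt I (1 : G) 1) := by
  set z := extChartAt I (1 : G) 1 with hz
  have hstrict : HasStrictFDerivAt (chartMul I G) (fderiv ℝ (chartMul I G) (z, z)) (z, z) :=
    contDiffAt_chartMul.hasStrictFDerivAt one_ne_zero
  have hleft : HasFDerivAt (fun x : E ↦ chartMul I G (x, z)) (ContinuousLinearMap.id ℝ E) z := by
    refine (hasFDerivAt_id z).congr_of_eventuallyEq ?_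
    filter_upwards [extChartAt_target_mem_nhds (I := I) (1 : G)] with x hx
    simp only [chartMul, hz, extChartAt_to_inv, mul_one, (extChartAt I (1 : G)).right_inv hx, id]
  have hright : HasFDerivAt (fun x : E ↦ chartMul I G (z, x)) (ContinuousLinearMap.id ℝ E) z := by
    refine (hasFDerivAt_id z).congr_of_eventuallyEq ?_
    filter_upwards [extChartAt_target_mem_nhds (I := I) (1 : G)] with x hx
    simp only [chartMul, hz, extChartAt_to_inv, one_mul, (extChartAt I (1 : G)).right_inv hx, id]
  have hinl := hleft.unique
    (hstrict.hasFDerivAt.comp (f := fun x ↦ (x, z)) z (hasFDerivAt_prodMk_left z z))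
  have hinr := hright.unique
    (hstrict.hasFDerivAt.comp (f := fun x ↦ (z, x)) z (hasFDerivAt_prodMk_right z z))
  refine hstrict.congr_fderiv ?_
  ext x
  · simpa using (DFunLike.congr_fun hinl x).symm
  · simpa using (DFunLike.congr_fun hinr x).symm

theorem HasStrictFDerivAtOne.mul {a b : W → G} {A B : W →L[ℝ] E} {w : W}
    (ha : HasStrictFDerivAtOne I a A w) (hb : HasStrictFDerivAtOne I b B w) :
    HasStrictFDerivAtOne I (fun x ↦ a x * b x) (A + B) w where
  map_eq_one := by rw [ha.map_eq_one, hb.map_eq_one, mul_one]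
  continuousAt := by
    have := continuousMul_of_contMDiffMul I 1 (G := G)
    exact ha.continuousAt.mul hb.continuousAt
  hasStrictFDerivAt := by
    have hmul : HasStrictFDerivAt (chartMul I G)
        (ContinuousLinearMap.fst ℝ E E + ContinuousLinearMap.snd ℝ E E)
        (extChartAt I (1 : G) (a w), extChartAt I (1 : G) (b w)) := by
      rw [ha.map_eq_one, hb.map_eq_one]
      exact hasStrictFDerivAt_chartMul
    have hsource : (extChartAt I (1 : G)).source ∈ 𝓝 (1 : G) := extChartAt_source_mem_nhds 1
    refine ((hmul.comp w (ha.hasStrictFDerivAt.prodMk hb.hasStrictFDerivAt)).congr_of_eventuallyEq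
      ?_).congr_fderiv (by ext; simp)
    filter_upwards [ha.continuousAt.preimage_mem_nhds (by rwa [ha.map_eq_one]),
      hb.continuousAt.preimage_mem_nhds (by rwa [hb.map_eq_one])] with x hax hbx
    simp only [chartMul, (extChartAt I (1 : G)).left_inv hax,
      (extChartAt I (1 : G)).left_inv hbx]

theorem HasVelocity.mul {a b : ℝ → G} {X Y : E} (ha : HasVelocity I a X)
    (hb : HasVelocity I b Y) : HasVelocity I (fun t ↦ a t * b t) (X + Y) := by
  simpa only [HasVelocity, ContinuousLinearMap.toSpanSingleton_add] using
    HasStrictFDerivAtOne.mul ha hb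

end DerivativeAtOne

section OneParameterSubgroup

variable {E : Type*} [NormedAddCommGroup E] [NormedSpace ℝ E]
  {H : Type*} [TopologicalSpace H] {I : ModelWithCorners ℝ E H}
  {G : Type*} [TopologicalSpace G] [ChartedSpace H G] [Group G]

/-- `γ` is the one-parameter subgroup of `G` with initial velocity `X`. -/
structure IsOneParameterSubgroup (I : ModelWithCorners ℝ E H) (γ : ℝ → G) (X : E) : Prop where
  map_add : ∀ s t, γ (s + t) = γ s * γ t
  continuous : Continuous γ
  hasVelocity : HasVelocity I γ X

namespace IsOneParameterSubgroup

variable {γ : ℝ → G} {X : E}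

theorem map_zero (h : IsOneParameterSubgroup I γ X) : γ 0 = 1 :=
  h.hasVelocity.map_eq_one

theorem map_neg (h : IsOneParameterSubgroup I γ X) (t : ℝ) : γ (-t) = (γ t)⁻¹ := by
  rw [eq_inv_iff_mul_eq_one, ← h.map_add, neg_add_cancel, h.map_zero]

theorem map_nsmul (h : IsOneParameterSubgroup I γ X) (n : ℕ) (t : ℝ) : γ (n * t) = γ t ^ n := by
  induction n with
  | zero => simp [h.map_zero]
  | succ n ih => rw [pow_succ, ← ih, ← h.map_add, Nat.cast_succ, add_one_mul]

theorem comp_const_mul (h : IsOneParameterSubgroup I γ X) (c : ℝ) :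
    IsOneParameterSubgroup I (fun t ↦ γ (c * t)) (c • X) where
  map_add s t := by rw [mul_add, h.map_add]
  continuous := h.continuous.comp (continuous_const_mul c)
  hasVelocity := h.hasVelocity.comp_const_mul c

end IsOneParameterSubgroup

theorem hasVelocity_of_isMIntegralCurve [IsManifold I 1 G] {v : (g : G) → TangentSpace I g}
    (hv : Continuous fun g ↦ (⟨g, v g⟩ : TangentBundle I G)) {γ : ℝ → G}
    (hγ : IsMIntegralCurve γ v) (hγ0 : γ 0 = 1) : HasVelocity I γ (v 1) := by
  have hvel_cont : ContinuousAt (fun t ↦ tangentCoordChange I (γ t) 1 (γ t) (v (γ t))) 0 := by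
    have hsection : ContinuousAt (fun t ↦ (⟨γ t, v (γ t)⟩ : TangentBundle I G)) 0 :=
      (hv.comp hγ.continuous).continuousAt
    rw [← hγ0]
    exact ((FiberBundle.continuousAt_totalSpace E _).1 hsection).2
  have hderiv := (hγ.isMIntegralCurveAt 0).eventually_hasDerivAt
  rw [hγ0] at hderiv
  have hvel_zero : tangentCoordChange I (γ 0) 1 (γ 0) (v (γ 0)) = v 1 := by
    rw [hγ0]
    exact tangentCoordChange_self (mem_extChartAt_source (1 : G))
  exact ⟨hγ0, hγ.continuous.continuousAt,
    hvel_zero ▸ hasStrictDerivAt_of_hasDerivAt_of_continuousAt hderiv hvel_cont⟩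

theorem IsOneParameterSubgroup.map [I.Boundaryless] [IsManifold I 1 G]
    {E' : Type*} [NormedAddCommGroup E'] [NormedSpace ℝ E']
    {H' : Type*} [TopologicalSpace H'] {I' : ModelWithCorners ℝ E' H'}
    {G' : Type*} [TopologicalSpace G'] [ChartedSpace H' G'] [Group G'] [IsManifold I' 1 G']
    {γ : ℝ → G} {X : E} (h : IsOneParameterSubgroup I γ X) (f : G →* G')
    (hf : ContMDiff I I' 1 f) :
    IsOneParameterSubgroup I' (fun t ↦ f (γ t)) (derivAtOne I I' f X) where
  map_add s t := by rw [h.map_add, f.map_mul]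
  continuous := hf.continuous.comp h.continuous
  hasVelocity := h.hasVelocity.map hf.contMDiffAt f.map_one

theorem mulInvariantVectorField_apply_one (X : GroupLieAlgebra I G) :
    mulInvariantVectorField X (1 : G) = X := by
  have hone : ((1 : G) * ·) = id := funext one_mul
  rw [mulInvariantVectorField, hone, mfderiv_id]
  rfl

variable [LieGroup I ∞ G]

theorem mfderiv_const_mul_mulInvariantVectorField (X : GroupLieAlgebra I G) (g h : G) :
    mfderiv I I (g * ·) h (mulInvariantVectorField X h) = mulInvariantVectorField X (g * h) := by
  have hdiff (g h : G) : MDifferentiableAt I I (g * ·) h :=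
    (contMDiff_mul_left (I := I) (n := ∞) (a := g)).mdifferentiableAt (by simp)
  have hcomp : (g * ·) ∘ (h * ·) = (g * h * ·) := by
    ext x; exact (mul_assoc g h x).symm
  refine (mfderiv_comp_apply_of_eq (1 : G) (hdiff g h) (hdiff h 1) (mul_one h) X).symm.trans ?_
  rw [hcomp]
  rfl

theorem isMIntegralCurveOn_const_mul {X : GroupLieAlgebra I G} {γ : ℝ → G} {s : Set ℝ}
    (hγ : IsMIntegralCurveOn γ (mulInvariantVectorField X) s) (g : G) :
    IsMIntegralCurveOn (fun t ↦ g * γ t) (mulInvariantVectorField X) s := by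
  intro t ht
  have hdiff : MDifferentiableAt I I (g * ·) (γ t) :=
    (contMDiff_mul_left (I := I) (n := ∞) (a := g)).mdifferentiableAt (by simp)
  refine (hdiff.hasMFDerivAt.comp_hasMFDerivWithinAt t (hγ t ht)).congr_mfderiv ?_
  refine ContinuousLinearMap.ext fun c ↦ ?_
  rw [← mfderiv_const_mul_mulInvariantVectorField]
  exact (mfderiv I I (g * ·) (γ t)).map_smul (c : ℝ) (mulInvariantVectorField X (γ t))

theorem contMDiff_one_mulInvariantVectorField (X : GroupLieAlgebra I G) :
    ContMDiff I I.tangent 1 fun g ↦ (⟨g, mulInvariantVectorField X g⟩ : TangentBundle I G) := by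
  have : LieGroup I (minSmoothness ℝ 3) G := by
    rw [minSmoothness_of_isRCLikeNormedField]; infer_instance
  exact (contMDiff_mulInvariantVectorField X).of_le (by simp)

variable [I.Boundaryless] [CompleteSpace E]

theorem exists_isMIntegralCurve_mulInvariantVectorField (X : GroupLieAlgebra I G) :
    ∃ γ : ℝ → G, γ 0 = 1 ∧ IsMIntegralCurve γ (mulInvariantVectorField X) := by
  have := topologicalGroup_of_lieGroup I ∞ (G := G)
  have := I.t1Space G
  have hsmooth := contMDiff_one_mulInvariantVectorField X
  obtain ⟨γ₀, hγ₀_zero, hγ₀⟩ :=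
    exists_isMIntegralCurveAt_of_contMDiffAt_boundaryless 0 (hsmooth.contMDiffAt (x := (1 : G)))
  obtain ⟨ε, hε, hγ₀⟩ := isMIntegralCurveAt_iff'.1 hγ₀
  rw [Real.ball_eq_Ioo, zero_sub, zero_add] at hγ₀
  exact exists_isMIntegralCurve_of_isMIntegralCurveOn hsmooth hε
    (fun g ↦ ⟨fun t ↦ g * γ₀ t, by simp [hγ₀_zero], isMIntegralCurveOn_const_mul hγ₀ g⟩) 1

theorem exists_isOneParameterSubgroup (X : E) :
    ∃ γ : ℝ → G, IsOneParameterSubgroup I γ X := by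
  have := topologicalGroup_of_lieGroup I ∞ (G := G)
  have := I.t1Space G
  have hsmooth := contMDiff_one_mulInvariantVectorField (I := I) (G := G) X
  obtain ⟨γ, hγ_zero, hγ⟩ := exists_isMIntegralCurve_mulInvariantVectorField (I := I) (G := G) X
  refine ⟨γ, fun s t ↦ ?_, hγ.continuous, ?_⟩
  · have htranslate : IsMIntegralCurve (fun t ↦ γ s * γ t) (mulInvariantVectorField X) :=
      isMIntegralCurve_iff_isMIntegralCurveOn.2
        (isMIntegralCurveOn_const_mul (hγ.isMIntegralCurveOn _) _)
    have hshift := isMIntegralCurve_Ioo_eq_of_contMDiff_boundaryless (t₀ := 0) hsmooth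
      (hγ.comp_add s) htranslate (by simp [hγ_zero])
    simpa [add_comm] using congrFun hshift t
  · exact mulInvariantVectorField_apply_one (I := I) (G := G) X ▸
      hasVelocity_of_isMIntegralCurve hsmooth.continuous hγ hγ_zero

end OneParameterSubgroup

section PowerLimit

open Filter

theorem exists_norm_extChartAt_sub_le
    {E : Type*} [NormedAddCommGroup E] [NormedSpace ℝ E]
    {H : Type*} [TopologicalSpace H] {I : ModelWithCorners ℝ E H} [I.Boundaryless]
    {M : Type*} [TopologicalSpace M] [ChartedSpace H M]
    {E' : Type*} [NormedAddCommGroup E'] [NormedSpace ℝ E']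
    {H' : Type*} [TopologicalSpace H'] {I' : ModelWithCorners ℝ E' H'}
    {M' : Type*} [TopologicalSpace M'] [ChartedSpace H' M']
    {f : M → M'} {x₀ : M} (hf : ContMDiffAt I I' 1 f x₀) :
    ∃ C : ℝ, ∃ s ∈ 𝓝 x₀, ∀ x ∈ s, ∀ y ∈ s,
      ‖extChartAt I' (f x₀) (f x) - extChartAt I' (f x₀) (f y)‖ ≤
        C * ‖extChartAt I x₀ x - extChartAt I x₀ y‖ := by
  have hsmooth := (contMDiffAt_iff.1 hf).2
  rw [I.range_eq_univ, contDiffWithinAt_univ] at hsmooth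
  obtain ⟨C, T, hT, hlip⟩ := hsmooth.exists_lipschitzOnWith
  refine ⟨C, (extChartAt I x₀).source ∩ extChartAt I x₀ ⁻¹' T,
    inter_mem (extChartAt_source_mem_nhds x₀) ((continuousAt_extChartAt x₀).preimage_mem_nhds hT),
    fun x hx y hy ↦ ?_⟩
  simpa only [Function.comp_apply, (extChartAt I x₀).left_inv hx.1,
    (extChartAt I x₀).left_inv hy.1] using hlip.norm_sub_le hx.2 hy.2

variable {E : Type*} [NormedAddCommGroup E] [NormedSpace ℝ E]
  {H : Type*} [TopologicalSpace H] {I : ModelWithCorners ℝ E H}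
  {G : Type*} [TopologicalSpace G] [ChartedSpace H G] [Group G]

theorem HasVelocity.tendsto_natCast_mul_norm {r : ℝ → G} (hr : HasVelocity I r (0 : E)) (t : ℝ) :
    Tendsto (fun n : ℕ ↦ n * ‖extChartAt I (1 : G) (r (t / n)) - extChartAt I (1 : G) 1‖) atTop
      (𝓝 0) := by
  have hlim := (hr.hasStrictFDerivAt.hasFDerivAt.lim_real t).comp tendsto_natCast_atTop_atTop
  simpa [Function.comp_def, hr.map_eq_one, norm_smul, div_eq_inv_mul] using hlim.norm

theorem exists_norm_extChartAt_lt_subset {N : Set G} (hN : N ∈ 𝓝 (1 : G)) :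
    ∃ ρ > 0, ∀ g ∈ (extChartAt I (1 : G)).source,
      ‖extChartAt I (1 : G) g - extChartAt I (1 : G) 1‖ < ρ → g ∈ N := by
  have hpre := (continuousAt_extChartAt_symm (I := I) (1 : G)).preimage_mem_nhds
    (by rwa [extChartAt_to_inv])
  obtain ⟨ρ, hρ, hball⟩ := Metric.mem_nhds_iff.1 hpre
  refine ⟨ρ, hρ, fun g hg hdist ↦ ?_⟩
  simpa only [Set.mem_preimage, (extChartAt I (1 : G)).left_inv hg] using
    hball (mem_ball_iff_norm.2 hdist)

theorem tendsto_nhds_one_of_norm_extChartAt_sub_le {ι : Type*} {l : Filter ι} {x : ι → G}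
    {u : ι → ℝ} (hu : Tendsto u l (𝓝 0))
    (hx : ∀ᶠ i in l, x i ∈ (extChartAt I (1 : G)).source ∧
      ‖extChartAt I (1 : G) (x i) - extChartAt I (1 : G) 1‖ ≤ u i) :
    Tendsto x l (𝓝 1) := by
  have hchart : Tendsto (fun i ↦ extChartAt I (1 : G) (x i)) l (𝓝 (extChartAt I (1 : G) 1)) :=
    tendsto_iff_norm_sub_tendsto_zero.2 <|
      squeeze_zero' (Eventually.of_forall fun _ ↦ norm_nonneg _) (hx.mono fun _ h ↦ h.2) hu
  have hsymm := (continuousAt_extChartAt_symm (I := I) (1 : G)).tendsto.comp hchart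
  rw [extChartAt_to_inv] at hsymm
  exact hsymm.congr' (hx.mono fun i hi ↦ (extChartAt I (1 : G)).left_inv hi.1)

theorem IsOneParameterSubgroup.eventually_pow_mem {γ : ℝ → G} {X : E}
    (hγ : IsOneParameterSubgroup I γ X) {N : Set G} (hN : N ∈ 𝓝 1) :
    ∀ᶠ t in 𝓝 (0 : ℝ), ∀ n : ℕ, ∀ k < n, γ (t / n) ^ k ∈ N := by
  obtain ⟨t₀, ht₀, hγN⟩ := Metric.eventually_nhds_iff.1
    (hγ.hasVelocity.continuousAt.eventually_mem (by rwa [hγ.map_zero]))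
  refine Metric.eventually_nhds_iff.2 ⟨t₀, ht₀, fun t ht n k hk ↦ ?_⟩
  rw [← hγ.map_nsmul]
  refine hγN (lt_of_le_of_lt ?_ ht)
  have hn : (0 : ℝ) < n := by exact_mod_cast k.zero_le.trans_lt hk
  rw [Real.dist_eq, Real.dist_eq, sub_zero, sub_zero, abs_mul, abs_div, Nat.abs_cast, Nat.abs_cast,
    mul_div_left_comm]
  exact mul_le_of_le_one_right (abs_nonneg t) (div_le_one_of_le₀ (by exact_mod_cast hk.le) hn.le)

variable [I.Boundaryless] [LieGroup I 1 G]

theorem exists_norm_extChartAt_mul_conj_sub_le :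
    ∃ C > 0, ∃ N ∈ 𝓝 (1 : G), ∀ x ∈ N, ∀ c ∈ N, ∀ g ∈ N,
      x * (c * g * c⁻¹) ∈ (extChartAt I (1 : G)).source ∧
      ‖extChartAt I (1 : G) (x * (c * g * c⁻¹)) - extChartAt I (1 : G) x‖ ≤
        C * ‖extChartAt I (1 : G) g - extChartAt I (1 : G) 1‖ := by
  have := topologicalGroup_of_lieGroup I 1 (G := G)
  let f : G × G × G → G := fun p ↦ p.1 * (p.2.1 * p.2.2 * p.2.1⁻¹)
  have hf : ContMDiff (I.prod (I.prod I)) I 1 f :=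
    contMDiff_fst.mul (((contMDiff_fst.comp contMDiff_snd).mul
      (contMDiff_snd.comp contMDiff_snd)).mul (contMDiff_fst.comp contMDiff_snd).inv)
  have hf_one : f (1, 1, 1) = 1 := by simp [f]
  obtain ⟨C, s, hs, hlip⟩ := exists_norm_extChartAt_sub_le hf.contMDiffAt (x₀ := (1, 1, 1))
  have hsource : f ⁻¹' (extChartAt I (1 : G)).source ∈ 𝓝 (1, 1, 1) :=
    hf.continuous.continuousAt.preimage_mem_nhds
      (by rw [hf_one]; exact extChartAt_source_mem_nhds 1)
  obtain ⟨N₁, hN₁, M, hM, hsub⟩ := mem_nhds_prod_iff.1 (inter_mem hs hsource)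
  obtain ⟨N₂, hN₂, N₃, hN₃, hsub'⟩ := mem_nhds_prod_iff.1 hM
  refine ⟨max C 1, by positivity, N₁ ∩ (N₂ ∩ N₃), inter_mem hN₁ (inter_mem hN₂ hN₃),
    fun x hx c hc g hg ↦ ?_⟩
  have hmem {h : G} (hh : h ∈ N₃) : (x, c, h) ∈ s ∩ f ⁻¹' (extChartAt I (1 : G)).source :=
    hsub ⟨hx.1, hsub' ⟨hc.2.1, hh⟩⟩
  refine ⟨(hmem hg.2.2).2, ?_⟩
  have hdist := hlip _ (hmem hg.2.2).1 _ (hmem (mem_of_mem_nhds hN₃)).1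
  have hconj_one : f (x, c, 1) = x := by simp [f]
  have hdist_chart : ‖extChartAt (I.prod (I.prod I)) ((1, 1, 1) : G × G × G) (x, c, g) -
      extChartAt (I.prod (I.prod I)) ((1, 1, 1) : G × G × G) (x, c, 1)‖ =
      ‖extChartAt I (1 : G) g - extChartAt I (1 : G) 1‖ := by
    simp [Prod.norm_def]
  rw [hdist_chart, hconj_one, hf_one] at hdist
  exact hdist.trans (by gcongr; exact le_max_left _ _)

/-- Telescoping: `b ^ n * (d ^ n)⁻¹` is the product of the conjugates of `b * d⁻¹` by
`1, d, …, d ^ (n - 1)`. -/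
theorem exists_norm_extChartAt_pow_mul_inv_pow_le :
    ∃ C : ℝ, ∃ ρ > 0, ∃ N ∈ 𝓝 (1 : G), ∀ (b d : G) (n : ℕ),
      b * d⁻¹ ∈ N → (∀ k < n, d ^ k ∈ N) →
      n * (C * ‖extChartAt I (1 : G) (b * d⁻¹) - extChartAt I (1 : G) 1‖) < ρ →
      b ^ n * (d ^ n)⁻¹ ∈ (extChartAt I (1 : G)).source ∧
      ‖extChartAt I (1 : G) (b ^ n * (d ^ n)⁻¹) - extChartAt I (1 : G) 1‖ ≤
        n * (C * ‖extChartAt I (1 : G) (b * d⁻¹) - extChartAt I (1 : G) 1‖) := by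
  obtain ⟨C, hC, N, hN, hconj⟩ := exists_norm_extChartAt_mul_conj_sub_le (I := I) (G := G)
  obtain ⟨ρ, hρ, hball⟩ := exists_norm_extChartAt_lt_subset (I := I) hN
  refine ⟨C, ρ, hρ, N, hN, fun b d n hbd hd ↦ ?_⟩
  induction n with
  | zero => simp
  | succ n ih =>
    intro hlt
    push_cast at hlt ⊢
    have hlt' : n * (C * ‖extChartAt I (1 : G) (b * d⁻¹) - extChartAt I (1 : G) 1‖) < ρ :=
      lt_of_le_of_lt (by gcongr; linarith) hlt
    obtain ⟨hsource, hnorm⟩ := ih (fun k hk ↦ hd k (hk.trans n.lt_succ_self)) hlt'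
    have hmem := hball _ hsource (hnorm.trans_lt hlt')
    have htelescope : b ^ (n + 1) * (d ^ (n + 1))⁻¹ =
        b ^ n * (d ^ n)⁻¹ * (d ^ n * (b * d⁻¹) * (d ^ n)⁻¹) := by
      rw [pow_succ, pow_succ']; group
    rw [htelescope]
    obtain ⟨hsource', hnorm'⟩ := hconj _ hmem _ (hd n n.lt_succ_self) _ hbd
    refine ⟨hsource', (norm_sub_le_norm_sub_add_norm_sub _ _ _).trans
      ((add_le_add hnorm' hnorm).trans_eq ?_)⟩
    ring

theorem exists_tendsto_pow_mul_inv_pow :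
    ∃ N ∈ 𝓝 (1 : G), ∀ b d : ℕ → G,
      (∀ᶠ n in atTop, b n * (d n)⁻¹ ∈ N) → (∀ᶠ n in atTop, ∀ k < n, d n ^ k ∈ N) →
      Tendsto (fun n ↦ n * ‖extChartAt I (1 : G) (b n * (d n)⁻¹) - extChartAt I (1 : G) 1‖) atTop
        (𝓝 0) →
      Tendsto (fun n ↦ b n ^ n * (d n ^ n)⁻¹) atTop (𝓝 1) := by
  obtain ⟨C, ρ, hρ, N, hN, hpow⟩ := exists_norm_extChartAt_pow_mul_inv_pow_le (I := I) (G := G)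
  refine ⟨N, hN, fun b d hbd hd hlim ↦ ?_⟩
  have hbound := hlim.const_mul C
  rw [mul_zero] at hbound
  refine tendsto_nhds_one_of_norm_extChartAt_sub_le (I := I) hbound ?_
  filter_upwards [hbd, hd, hbound.eventually (gt_mem_nhds hρ)] with n hbd hd hlt
  rw [mul_left_comm] at hlt ⊢
  exact hpow _ _ n hbd hd hlt

namespace IsOneParameterSubgroup

variable {γ a : ℝ → G} {X : E}

theorem eventually_tendsto_pow (hγ : IsOneParameterSubgroup I γ X) (ha : HasVelocity I a X) :
    ∀ᶠ t in 𝓝 (0 : ℝ), Tendsto (fun n : ℕ ↦ a (t / n) ^ n) atTop (𝓝 (γ t)) := by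
  have := topologicalGroup_of_lieGroup I 1 (G := G)
  obtain ⟨N, hN, htendsto⟩ := exists_tendsto_pow_mul_inv_pow (I := I) (G := G)
  have hratio : HasVelocity I (fun s ↦ a s * (γ s)⁻¹) (0 : E) := by
    simpa [hγ.map_neg] using HasVelocity.mul ha (hγ.comp_const_mul (-1)).hasVelocity
  filter_upwards [hγ.eventually_pow_mem hN] with t ht
  have hratio_mem : ∀ᶠ n : ℕ in atTop, a (t / n) * (γ (t / n))⁻¹ ∈ N :=
    (tendsto_const_div_atTop_nhds_zero_nat t).eventually
      (hratio.continuousAt.eventually_mem (by rwa [hratio.map_eq_one]))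
  have hlim := (htendsto (fun n ↦ a (t / n)) (fun n ↦ γ (t / n)) hratio_mem
    (Eventually.of_forall ht) (hratio.tendsto_natCast_mul_norm t)).mul_const (γ t)
  rw [one_mul] at hlim
  refine hlim.congr' ?_
  filter_upwards [eventually_ne_atTop 0] with n hn
  rw [← hγ.map_nsmul, mul_div_cancel₀ _ (Nat.cast_ne_zero.2 hn), inv_mul_cancel_right]

theorem map_eq_of_map_curve_eq {K : Type*} [Group K] [TopologicalSpace K] [T2Space K]
    (hγ : IsOneParameterSubgroup I γ X) (ha : HasVelocity I a X) (π : G →* K) (hπ : Continuous π)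
    {f : ℝ → K} (hf : ∀ (n : ℕ) t, f (n * t) = f t ^ n) (haf : ∀ t, π (a t) = f t) (t : ℝ) :
    π (γ t) = f t := by
  have hsmall : ∀ᶠ s in 𝓝 (0 : ℝ), π (γ s) = f s := by
    filter_upwards [hγ.eventually_tendsto_pow ha] with s hs
    refine tendsto_nhds_unique ((hπ.tendsto _).comp hs) (tendsto_const_nhds.congr' ?_)
    filter_upwards [eventually_ne_atTop 0] with n hn
    have hcancel : (n : ℝ) * (s / n) = s := mul_div_cancel₀ s (Nat.cast_ne_zero.2 hn)
    rw [Function.comp_apply, map_pow, haf, ← hf, hcancel]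
  obtain ⟨n, hn, hn0⟩ := (((tendsto_const_div_atTop_nhds_zero_nat t).eventually hsmall).and
    (eventually_ne_atTop 0)).exists
  rw [← mul_div_cancel₀ t (Nat.cast_ne_zero.2 hn0), hγ.map_nsmul, map_pow, hn, hf]

theorem mem_of_curve_mem (hγ : IsOneParameterSubgroup I γ X) (ha : HasVelocity I a X)
    {B : Subgroup G} (hB : IsClosed (B : Set G)) (haB : ∀ t, a t ∈ B) (t : ℝ) : γ t ∈ B := by
  obtain ⟨n, hn, hn0⟩ := (((tendsto_const_div_atTop_nhds_zero_nat t).eventually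
    (hγ.eventually_tendsto_pow ha)).and (eventually_ne_atTop 0)).exists
  rw [← mul_div_cancel₀ t (Nat.cast_ne_zero.2 hn0), hγ.map_nsmul]
  exact pow_mem (hB.mem_of_tendsto hn (Eventually.of_forall fun _ ↦ pow_mem (haB _) _)) n

theorem unique {γ' : ℝ → G} (hγ : IsOneParameterSubgroup I γ X)
    (hγ' : IsOneParameterSubgroup I γ' X) : γ = γ' := by
  have := topologicalGroup_of_lieGroup I 1 (G := G)
  have := I.t1Space G
  exact funext (hγ.map_eq_of_map_curve_eq hγ'.hasVelocity (MonoidHom.id G) continuous_id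
    hγ'.map_nsmul fun _ ↦ rfl)

end IsOneParameterSubgroup

end PowerLimit

section LieExponential

open Filter
open scoped commutatorElement

variable {E : Type*} [NormedAddCommGroup E] [NormedSpace ℝ E]
  {H : Type*} [TopologicalSpace H] {I : ModelWithCorners ℝ E H}
  {G : Type*} [TopologicalSpace G] [ChartedSpace H G] [Group G]
  {W : Type*} [NormedAddCommGroup W] [NormedSpace ℝ W]

theorem HasStrictFDerivAtOne.map_nhds_eq_of_surj [I.Boundaryless] [CompleteSpace E]
    [CompleteSpace W] {a : W → G} {A : W →L[ℝ] E} {w : W} (ha : HasStrictFDerivAtOne I a A w)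
    (hA : A.range = ⊤) : Filter.map a (𝓝 w) = 𝓝 1 := by
  have hsymm : (fun x ↦ (extChartAt I (1 : G)).symm (extChartAt I (1 : G) (a x))) =ᶠ[𝓝 w] a := by
    filter_upwards [ha.continuousAt.preimage_mem_nhds
      (by rw [ha.map_eq_one]; exact extChartAt_source_mem_nhds (I := I) (1 : G))] with x hx
    exact (extChartAt I (1 : G)).left_inv hx
  have hchart := ha.hasStrictFDerivAt.map_nhds_eq_of_surj hA
  have hinv := map_extChartAt_symm_nhdsWithin_range (I := I) (1 : G)
  rw [I.range_eq_univ, nhdsWithin_univ] at hinv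
  rw [ha.map_eq_one] at hchart
  rw [← map_congr hsymm, ← hinv, ← hchart, Filter.map_map, Function.comp_def]

theorem HasStrictFDerivAtOne.list_prod [I.Boundaryless] [LieGroup I 1 G] {ι : Type*}
    {a : ι → W → G} {A : ι → W →L[ℝ] E} {w : W} (h : ∀ i, HasStrictFDerivAtOne I (a i) (A i) w)
    (l : List ι) :
    HasStrictFDerivAtOne I (fun x ↦ (l.map fun i ↦ a i x).prod) (l.map A).sum w := by
  induction l with
  | nil => exact .one w
  | cons i l ih => simpa only [List.map_cons, List.prod_cons, List.sum_cons] using (h i).mul ih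

variable [LieGroup I ∞ G] [I.Boundaryless] [CompleteSpace E]

variable (I) in
/-- The exponential map of the Lie group `G`, on the model space `E` of the Lie algebra. -/
noncomputable def lieExp (X : E) : G :=
  (exists_isOneParameterSubgroup (I := I) X).choose 1

theorem isOneParameterSubgroup_lieExp (X : E) :
    IsOneParameterSubgroup I (fun t : ℝ ↦ (lieExp I (t • X) : G)) X := by
  obtain ⟨γ, hγ⟩ := exists_isOneParameterSubgroup (I := I) (G := G) X
  have hγ_eq : (fun t : ℝ ↦ (lieExp I (t • X) : G)) = γ := by
    ext t
    have hchoose := (exists_isOneParameterSubgroup (I := I) (G := G) (t • X)).choose_spec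
    exact (congrFun (hchoose.unique (hγ.comp_const_mul t)) 1).trans (by rw [mul_one])
  rwa [hγ_eq]

theorem lieExp_zero : (lieExp I (0 : E) : G) = 1 := by
  simpa using (isOneParameterSubgroup_lieExp (I := I) (G := G) 0).map_zero

theorem lieExp_neg (X : E) : (lieExp I (-X) : G) = (lieExp I X)⁻¹ := by
  simpa using (isOneParameterSubgroup_lieExp (I := I) (G := G) X).map_neg 1

theorem lieExp_natCast_smul (n : ℕ) (X : E) : (lieExp I ((n : ℝ) • X) : G) = lieExp I X ^ n := by
  simpa using (isOneParameterSubgroup_lieExp (I := I) (G := G) X).map_nsmul n 1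

theorem tendsto_lieExp_smul (X : E) :
    Tendsto (fun t : ℝ ↦ (lieExp I (t • X) : G)) (𝓝 0) (𝓝 1) := by
  simpa [lieExp_zero] using (isOneParameterSubgroup_lieExp (I := I) (G := G) X).continuous.tendsto 0

theorem map_lieExp
    {E' : Type*} [NormedAddCommGroup E'] [NormedSpace ℝ E'] [CompleteSpace E']
    {H' : Type*} [TopologicalSpace H'] {I' : ModelWithCorners ℝ E' H'} [I'.Boundaryless]
    {G' : Type*} [TopologicalSpace G'] [ChartedSpace H' G'] [Group G'] [LieGroup I' ∞ G']
    (f : G →* G') (hf : ContMDiff I I' 1 f) (X : E) :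
    f (lieExp I X) = lieExp I' (derivAtOne I I' f X) := by
  simpa using congrFun (((isOneParameterSubgroup_lieExp X).map f hf).unique
    (isOneParameterSubgroup_lieExp _)) 1

theorem conj_lieExp (g : G) (X : E) :
    g * lieExp I X * g⁻¹ = lieExp I (derivAtOne I I (MulAut.conj g) X) :=
  map_lieExp (MulAut.conj g).toMonoidHom (contMDiff_mul_right.comp contMDiff_mul_left) X

theorem hasVelocity_lieExp_smul (X : E) : HasVelocity I (fun t : ℝ ↦ (lieExp I (t • X) : G)) X :=
  (isOneParameterSubgroup_lieExp X).hasVelocity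

theorem hasVelocity_lieExp_smul_mul (X Y : E) :
    HasVelocity I (fun t : ℝ ↦ (lieExp I (t • X) * lieExp I (t • Y) : G)) (X + Y) :=
  (hasVelocity_lieExp_smul X).mul (hasVelocity_lieExp_smul Y)

theorem lieExp_smul_mem_of_curve_mem {a : ℝ → G} {X : E} (ha : HasVelocity I a X)
    {B : Subgroup G} (hB : IsClosed (B : Set G)) (haB : ∀ t, a t ∈ B) (t : ℝ) :
    lieExp I (t • X) ∈ B :=
  (isOneParameterSubgroup_lieExp X).mem_of_curve_mem ha hB haB t

variable (I) in
/-- The Lie algebra of a closed subgroup, as a subspace of the model space. -/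
noncomputable def lieSubmodule (A : Subgroup G) (hA : IsClosed (A : Set G)) : Submodule ℝ E where
  carrier := {X | ∀ t : ℝ, lieExp I (t • X) ∈ A}
  zero_mem' t := by rw [smul_zero, lieExp_zero]; exact one_mem A
  add_mem' {X Y} hX hY := lieExp_smul_mem_of_curve_mem (hasVelocity_lieExp_smul_mul X Y) hA
    fun t ↦ mul_mem (hX t) (hY t)
  smul_mem' c X hX t := by rw [smul_smul]; exact hX _

theorem map_derivAtOne_mem_lieSubmodule {A : Subgroup G} {hA : IsClosed (A : Set G)} (f : G →* G)
    (hf : ContMDiff I I 1 f) (hfA : A ≤ A.comap f) {X : E} (hX : X ∈ lieSubmodule I A hA) :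
    derivAtOne I I f X ∈ lieSubmodule I A hA := fun t ↦ by
  rw [← map_smul, ← map_lieExp f hf]
  exact hfA (hX t)

theorem map_lieExp_eq_of_map_curve_eq {K : Type*} [Group K] [TopologicalSpace K] [T2Space K]
    {a : ℝ → G} {X : E} (ha : HasVelocity I a X) (π : G →* K) (hπ : Continuous π)
    {f : ℝ → K} (hf : ∀ (n : ℕ) t, f (n * t) = f t ^ n) (haf : ∀ t, π (a t) = f t) :
    π (lieExp I X) = f 1 := by
  simpa using (isOneParameterSubgroup_lieExp X).map_eq_of_map_curve_eq ha π hπ hf haf 1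

variable (I) in
/-- The subgroup generated by the exponentials of the Lie algebra of a closed subgroup. -/
noncomputable def expSubgroup (A : Subgroup G) (hA : IsClosed (A : Set G)) : Subgroup G :=
  Subgroup.closure (lieExp I '' (lieSubmodule I A hA : Set E))

theorem closure_range_lieExp [FiniteDimensional ℝ E] [ConnectedSpace G] :
    Subgroup.closure (Set.range (lieExp I : E → G)) = ⊤ := by
  have := topologicalGroup_of_lieGroup I ∞ (G := G)
  let b := Module.finBasis ℝ E
  let coord i : E →L[ℝ] ℝ := (b.coord i).toContinuousLinearMap
  have hderiv := HasStrictFDerivAtOne.list_prod (I := I) (G := G) (w := (0 : E))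
    (a := fun i x ↦ lieExp I (coord i x • b i))
    (A := fun i ↦ (ContinuousLinearMap.toSpanSingleton ℝ (b i)).comp (coord i))
    (fun i ↦ HasStrictFDerivAtOne.comp (f := coord i)
      (by rw [map_zero]; exact hasVelocity_lieExp_smul (I := I) (G := G) (b i))
      (coord i).hasStrictFDerivAt)
    (List.finRange _)
  have hderiv_eq_id : ((List.finRange (Module.finrank ℝ E)).map fun i ↦
      (ContinuousLinearMap.toSpanSingleton ℝ (b i)).comp (coord i)).sum =
      ContinuousLinearMap.id ℝ E := by
    rw [← List.ofFn_eq_map, List.sum_ofFn]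
    ext x
    simp [coord]
  rw [hderiv_eq_id] at hderiv
  have hnhds : (Subgroup.closure (Set.range (lieExp I : E → G)) : Set G) ∈ 𝓝 1 := by
    rw [← hderiv.map_nhds_eq_of_surj (by simp)]
    refine Filter.mem_map.2 (univ_mem' fun x ↦ Subgroup.list_prod_mem _ fun g hg ↦ ?_)
    obtain ⟨i, -, rfl⟩ := List.mem_map.1 hg
    exact Subgroup.subset_closure ⟨_, rfl⟩
  have hopen := Subgroup.isOpen_of_mem_nhds _ hnhds
  exact SetLike.coe_injective
    (IsClopen.eq_univ ⟨Subgroup.isClosed_of_isOpen _ hopen, hopen⟩ ⟨1, one_mem _⟩)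

theorem expSubgroup_top [FiniteDimensional ℝ E] [ConnectedSpace G] :
    expSubgroup I (⊤ : Subgroup G) isClosed_univ = ⊤ := by
  have htop : (lieSubmodule I (⊤ : Subgroup G) isClosed_univ : Set E) = Set.univ :=
    Set.eq_univ_of_forall fun _ _ ↦ trivial
  rw [expSubgroup, htop, Set.image_univ, closure_range_lieExp]

instance expSubgroup_normal (A : Subgroup G) [hA : A.Normal] (hAc : IsClosed (A : Set G)) :
    (expSubgroup I A hAc).Normal := by
  refine ⟨fun x hx g ↦ ?_⟩
  suffices h : expSubgroup I A hAc ≤ (expSubgroup I A hAc).comap (MulAut.conj g).toMonoidHom from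
    h hx
  refine (Subgroup.closure_le _).2 ?_
  rintro _ ⟨X, hX, rfl⟩
  refine Subgroup.subset_closure ⟨_, fun t ↦ ?_, (conj_lieExp g X).symm⟩
  rw [← map_smul, ← conj_lieExp]
  exact hA.conj_mem _ (hX t) g

theorem derivAtOne_conj_sub_mem_lieSubmodule {B : Subgroup G} {hB : IsClosed (B : Set G)} {g : G}
    {X : E} (h : ∀ t : ℝ, ⁅g, lieExp I (t • X)⁆ ∈ B) :
    derivAtOne I I (MulAut.conj g) X - X ∈ lieSubmodule I B hB := by
  have hvel := hasVelocity_lieExp_smul_mul (I := I) (G := G) (derivAtOne I I (MulAut.conj g) X) (-X)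
  rw [← sub_eq_add_neg] at hvel
  refine lieExp_smul_mem_of_curve_mem hvel hB fun t ↦ ?_
  rw [smul_neg, lieExp_neg, ← map_smul, ← conj_lieExp]
  exact h t

theorem mem_comap_centralizer_mk {K : Type*} [Group K] {B : Subgroup K} [B.Normal] {g x : K} :
    x ∈ (Subgroup.centralizer {(g : K ⧸ B)}).comap (QuotientGroup.mk' B) ↔ ⁅g, x⁆ ∈ B := by
  rw [Subgroup.mem_comap, Subgroup.mem_centralizer_singleton_iff, ← QuotientGroup.eq_one_iff]
  exact eq_comm.trans commutatorElement_eq_one_iff_mul_comm.symm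

variable [IsTopologicalGroup G]

theorem mk_lieExp_eq_of_sub_mem (B : Subgroup G) [B.Normal] (hB : IsClosed (B : Set G))
    {X Y : E} (h : Y - X ∈ lieSubmodule I B hB) :
    ((lieExp I Y : G) : G ⧸ B) = (lieExp I X : G) := by
  have hvel := hasVelocity_lieExp_smul_mul (I := I) (G := G) X (Y - X)
  rw [add_sub_cancel] at hvel
  have := hB
  simpa using map_lieExp_eq_of_map_curve_eq hvel (QuotientGroup.mk' B) QuotientGroup.continuous_mk
    (f := fun t ↦ ((lieExp I (t • X) : G) : G ⧸ B))
    (fun n t ↦ by rw [mul_smul, lieExp_natCast_smul, QuotientGroup.mk_pow])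
    (fun t ↦ by simp [(QuotientGroup.eq_one_iff _).2 (h t)])

theorem mk_lieExp_add {A B : Subgroup G} [B.Normal] {hA : IsClosed (A : Set G)}
    (hB : IsClosed (B : Set G)) (hAB : ⁅A, A⁆ ≤ B) {X Y : E}
    (hX : X ∈ lieSubmodule I A hA) (hY : Y ∈ lieSubmodule I A hA) :
    ((lieExp I (X + Y) : G) : G ⧸ B) = (lieExp I X : G) * (lieExp I Y : G) := by
  have := hB
  have hcomm (t : ℝ) : Commute ((lieExp I (t • X) : G) : G ⧸ B) (lieExp I (t • Y) : G) := by
    rw [← commutatorElement_eq_one_iff_commute]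
    exact (QuotientGroup.eq_one_iff _).2
      (hAB (Subgroup.commutator_mem_commutator (hX t) (hY t)))
  simpa using map_lieExp_eq_of_map_curve_eq (hasVelocity_lieExp_smul_mul X Y)
    (QuotientGroup.mk' B) QuotientGroup.continuous_mk
    (f := fun t ↦ ((lieExp I (t • X) : G) : G ⧸ B) * (lieExp I (t • Y) : G))
    (fun n t ↦ by simp [mul_smul, lieExp_natCast_smul, (hcomm t).mul_pow]) (fun t ↦ rfl)

theorem commutatorElement_lieExp_mem_topologicalClosure {B : Subgroup G} [B.Normal]
    {hB : IsClosed (B : Set G)} {g : G} {X : E} (h : ∀ t : ℝ, ⁅g, lieExp I (t • X)⁆ ∈ B) :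
    ⁅g, lieExp I X⁆ ∈ (expSubgroup I B hB).topologicalClosure := by
  have := Subgroup.is_normal_topologicalClosure (expSubgroup I B hB)
  have hmem : derivAtOne I I (MulAut.conj g) X - X ∈
      lieSubmodule I _ (Subgroup.isClosed_topologicalClosure (expSubgroup I B hB)) := fun t ↦
    Subgroup.le_topologicalClosure _ (Subgroup.subset_closure
      ⟨_, Submodule.smul_mem _ t (derivAtOne_conj_sub_mem_lieSubmodule h), rfl⟩)
  have heq := mk_lieExp_eq_of_sub_mem _ _ hmem
  rw [← conj_lieExp] at heq
  rw [commutatorElement_def, ← QuotientGroup.eq_one_iff, QuotientGroup.mk_mul, heq,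
    ← QuotientGroup.mk_mul, mul_inv_cancel, QuotientGroup.mk_one]

theorem isClosed_comap_centralizer_mk (B : Subgroup G) [B.Normal] (hB : IsClosed (B : Set G))
    (g : G) : IsClosed
      ((Subgroup.centralizer {(g : G ⧸ B)}).comap (QuotientGroup.mk' B) : Set G) := by
  have := hB
  exact (Set.isClosed_centralizer _).preimage QuotientGroup.continuous_mk

theorem topologicalClosure_commutator_le {A : Subgroup G} [A.Normal] {hA : IsClosed (A : Set G)}
    (hgen : A ≤ (expSubgroup I A hA).topologicalClosure) :
    ⁅A, A⁆.topologicalClosure ≤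
      (expSubgroup I _ (Subgroup.isClosed_topologicalClosure ⁅A, A⁆)).topologicalClosure := by
  have hnormal := Subgroup.is_normal_topologicalClosure ⁅A, A⁆
  set B' := (expSubgroup I _ (Subgroup.isClosed_topologicalClosure ⁅A, A⁆)).topologicalClosure
  have hB' : B'.Normal := Subgroup.is_normal_topologicalClosure _
  have hB'_closed : IsClosed (B' : Set G) := Subgroup.isClosed_topologicalClosure _
  refine Subgroup.topologicalClosure_minimal _ (Subgroup.commutator_le.2 fun g hg h hh ↦ ?_)
    hB'_closed
  refine mem_comap_centralizer_mk.1 (Subgroup.topologicalClosure_minimal _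
    ((Subgroup.closure_le _).2 ?_) (isClosed_comap_centralizer_mk B' hB'_closed g) (hgen hh))
  rintro _ ⟨X, hX, rfl⟩
  exact mem_comap_centralizer_mk.2 (commutatorElement_lieExp_mem_topologicalClosure fun t ↦
    Subgroup.le_topologicalClosure _ (Subgroup.commutator_mem_commutator hg (hX t)))

end LieExponential

section ClosedDerivedSeries

open scoped commutatorElement

variable (G : Type*) [Group G] [TopologicalSpace G] [IsTopologicalGroup G]

/-- The closed derived series of a topological group: each term is the closure of the commutator
subgroup of the previous one. -/
def closedDerivedSeries : ℕ → Subgroup G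
  | 0 => ⊤
  | n + 1 => ⁅closedDerivedSeries n, closedDerivedSeries n⁆.topologicalClosure

theorem isClosed_closedDerivedSeries (n : ℕ) : IsClosed (closedDerivedSeries G n : Set G) := by
  cases n with
  | zero => exact isClosed_univ
  | succ n => exact Subgroup.isClosed_topologicalClosure _

instance closedDerivedSeries_normal (n : ℕ) : (closedDerivedSeries G n).Normal := by
  induction n with
  | zero => exact inferInstanceAs (⊤ : Subgroup G).Normal
  | succ n ih => exact Subgroup.is_normal_topologicalClosure _

variable {G}

theorem commutator_topologicalClosure_le (A : Subgroup G) :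
    ⁅A.topologicalClosure, A.topologicalClosure⁆ ≤ ⁅A, A⁆.topologicalClosure := by
  have hcont : Continuous (Function.uncurry fun x y : G ↦ ⁅x, y⁆) := by
    simp only [Function.uncurry_def, commutatorElement_def]
    fun_prop
  exact Subgroup.commutator_le.2 fun g hg h hh ↦ map_mem_closure₂ hcont hg hh
    fun x hx y hy ↦ Subgroup.commutator_mem_commutator hx hy

theorem closedDerivedSeries_le_topologicalClosure_derivedSeries (n : ℕ) :
    closedDerivedSeries G n ≤ (derivedSeries G n).topologicalClosure := by
  induction n with
  | zero => exact Subgroup.le_topologicalClosure _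
  | succ n ih =>
    exact Subgroup.topologicalClosure_minimal _
      ((Subgroup.commutator_mono ih ih).trans (commutator_topologicalClosure_le _))
      (Subgroup.isClosed_topologicalClosure _)

theorem exists_closedDerivedSeries_eq_bot [T1Space G] [hG : Group.IsSolvable G] :
    ∃ n, closedDerivedSeries G n = ⊥ := by
  obtain ⟨n, hn⟩ := hG.solvable
  refine ⟨n, le_bot_iff.1 ((closedDerivedSeries_le_topologicalClosure_derivedSeries n).trans ?_)⟩
  rw [hn]
  exact Subgroup.topologicalClosure_minimal _ le_rfl isClosed_singleton

theorem closedDerivedSeries_le_comap {f : G →* G} (hf : Continuous f) (n : ℕ) :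
    closedDerivedSeries G n ≤ (closedDerivedSeries G n).comap f := by
  induction n with
  | zero => exact fun _ _ ↦ trivial
  | succ n ih =>
    refine Subgroup.topologicalClosure_minimal _ (Subgroup.commutator_le.2 fun x hx y hy ↦ ?_)
      ((isClosed_closedDerivedSeries G (n + 1)).preimage hf)
    rw [Subgroup.mem_comap, map_commutatorElement]
    exact Subgroup.le_topologicalClosure _ (Subgroup.commutator_mem_commutator (ih hx) (ih hy))

theorem closedDerivedSeries_le_topologicalClosure_expSubgroup
    {E : Type*} [NormedAddCommGroup E] [NormedSpace ℝ E] [FiniteDimensional ℝ E] [CompleteSpace E]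
    {H : Type*} [TopologicalSpace H] (I : ModelWithCorners ℝ E H) [I.Boundaryless]
    [ChartedSpace H G] [LieGroup I ∞ G] [ConnectedSpace G] (n : ℕ) :
    closedDerivedSeries G n ≤
      (expSubgroup I _ (isClosed_closedDerivedSeries G n)).topologicalClosure := by
  induction n with
  | zero => exact (expSubgroup_top (I := I)).ge.trans (Subgroup.le_topologicalClosure _)
  | succ n ih => exact topologicalClosure_commutator_le ih

end ClosedDerivedSeries

section UnipotentExtrapolation

theorem exists_sum_smul_pow_eq_one {R : Type*} [Ring R] [Algebra ℝ R] (m : ℕ) :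
    ∃ c : ℕ → ℝ, ∀ u : R, (1 - u) ^ m = 0 → ∑ k ∈ Finset.range m, c k • u ^ (k + 1) = 1 := by
  refine ⟨fun k ↦ -((-1) ^ (k + 1) * m.choose (k + 1)), fun u hu ↦ ?_⟩
  rw [sub_eq_neg_add, (Commute.one_right _).add_pow, Finset.sum_range_succ'] at hu
  simp only [one_pow, mul_one, pow_zero, Nat.choose_zero_right, Nat.cast_one] at hu
  rw [eq_neg_of_add_eq_zero_right hu, ← Finset.sum_neg_distrib]
  refine Finset.sum_congr rfl fun k _ ↦ ?_
  rw [neg_smul, mul_comm, mul_smul, Nat.cast_smul_eq_nsmul, neg_pow u, nsmul_eq_mul,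
    ← Nat.cast_comm]
  rcases (k + 1).even_or_odd with hk | hk <;> simp [hk.neg_one_pow]

variable {R : Type*} [NormedRing R] [NormedAlgebra ℝ R] {a : R} {m : ℕ}

theorem one_sub_exp_pow_eq_zero (ha : a ^ m = 0) : (1 - NormedSpace.exp a) ^ m = 0 := by
  let b := ∑ n ∈ Finset.range m, ((n + 1).factorial : ℝ)⁻¹ • a ^ n
  have hab : Commute a b :=
    Commute.sum_right _ _ _ fun n _ ↦ ((Commute.refl a).pow_right n).smul_right _
  have hexp : NormedSpace.exp a = 1 + a * b := by
    have hvanish (n : ℕ) (hn : n ∉ Finset.range (m + 1)) : (n.factorial : ℝ)⁻¹ • a ^ n = 0 := by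
      rw [pow_eq_zero_of_le (by grind) ha, smul_zero]
    simp only [NormedSpace.exp_eq_tsum ℝ]
    rw [tsum_eq_sum hvanish, Finset.sum_range_succ', Finset.mul_sum, add_comm]
    simp [pow_succ']
  rw [hexp, sub_add_cancel_left, ← mul_neg, hab.neg_right.mul_pow, ha, zero_mul]

theorem exists_sum_smul_exp_eq_one [CompleteSpace R] (ha : a ^ m = 0) :
    ∃ c : ℕ → ℝ, ∀ q : ℝ,
      ∑ k ∈ Finset.range m, c k • NormedSpace.exp (((k + 1) * q) • a) = 1 := by
  let : NormedAlgebra ℚ R := NormedAlgebra.restrictScalars ℚ ℝ R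
  obtain ⟨c, hc⟩ := exists_sum_smul_pow_eq_one (R := R) m
  refine ⟨c, fun q ↦ ?_⟩
  rw [← hc _ (one_sub_exp_pow_eq_zero (a := q • a) (by rw [smul_pow, ha, smul_zero]))]
  refine Finset.sum_congr rfl fun k _ ↦ ?_
  rw [mul_smul, ← Nat.cast_succ, Nat.cast_smul_eq_nsmul, NormedSpace.exp_nsmul]

end UnipotentExtrapolation

namespace AutomorphismFlow

section FlowProducts

variable {E : Type*} [NormedAddCommGroup E] [NormedSpace ℝ E]
  {H : Type*} [TopologicalSpace H] {I : ModelWithCorners ℝ E H}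
  {G : Type*} [TopologicalSpace G] [ChartedSpace H G] [Group G]

/-- The automorphism `φ_t` as a group homomorphism. -/
def hom (φ : AutomorphismFlow I G) (t : ℝ) : G →* G :=
  MonoidHom.mk' (φ t) (φ.map_mul' t)

theorem apply_one (φ : AutomorphismFlow I G) (t : ℝ) : φ t 1 = 1 :=
  (φ.hom t).map_one

/-- The flow `t ↦ φ_{-t}`. -/
def reverse (φ : AutomorphismFlow I G) : AutomorphismFlow I G where
  toFlow := φ.toFlow.reverse
  map_mul' t := φ.map_mul' (-t)
  contMDiff' t := φ.contMDiff' (-t)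

theorem IsNilpotentFlow.reverse {φ : AutomorphismFlow I G} (hφ : φ.IsNilpotentFlow) :
    φ.reverse.IsNilpotentFlow := by
  obtain ⟨D, hD, hnil⟩ := hφ
  exact ⟨-D, fun t ↦ by rw [smul_neg, ← neg_smul]; exact hD (-t), hnil.neg⟩

/-- `φ.FlowProduct U τ a b g`: `g` is a product `φ_{S₁}(u₁) ⋯ φ_{Sₙ}(uₙ)` with `uᵢ ∈ U` and times
`S₁ > ⋯ > Sₙ` in `[a + τ, b - τ]` at distance at least `2 τ` from each other. -/
inductive FlowProduct (φ : AutomorphismFlow I G) (U : Set G) (τ : ℝ) : ℝ → ℝ → G → Prop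
  | single {a b S : ℝ} {u : G} (ha : a + τ ≤ S) (hb : S + τ ≤ b) (hu : u ∈ U) :
      FlowProduct φ U τ a b (φ S u)
  | mul {a b c : ℝ} {g h : G} (hg : FlowProduct φ U τ b c g) (hh : FlowProduct φ U τ a b h) :
      FlowProduct φ U τ a c (g * h)

variable {φ : AutomorphismFlow I G} {U : Set G} {τ : ℝ}

theorem FlowProduct.one (hU : (1 : G) ∈ U) {a b : ℝ} (hab : a + 2 * τ ≤ b) :
    φ.FlowProduct U τ a b 1 := by
  simpa only [φ.apply_one] using
    FlowProduct.single (φ := φ) (S := a + τ) le_rfl (by linarith) hU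

variable (φ) in
/-- The elements that are flow products with arbitrarily late times. -/
def lateProducts (hU : (1 : G) ∈ U) (τ : ℝ) : Submonoid G where
  carrier := {y | ∀ a, ∃ b, φ.FlowProduct U τ a b y}
  one_mem' a := ⟨a + 2 * τ, .one hU le_rfl⟩
  mul_mem' hx hy a :=
    have ⟨b, hb⟩ := hy a
    have ⟨c, hc⟩ := hx b
    ⟨c, hc.mul hb⟩

theorem isClosed_lateProducts [IsTopologicalGroup G] (hU : U ∈ 𝓝 (1 : G)) :
    IsClosed (φ.lateProducts (mem_of_mem_nhds hU) τ : Set G) := by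
  refine isClosed_of_closure_subset fun y hy a ↦ ?_
  have hcont : Continuous fun x ↦ φ (-(a + τ)) (x⁻¹ * y) :=
    (φ.contMDiff' _).continuous.comp (by fun_prop)
  have hnhds : (fun x ↦ φ (-(a + τ)) (x⁻¹ * y)) ⁻¹' U ∈ 𝓝 y :=
    hcont.continuousAt.preimage_mem_nhds (by rwa [inv_mul_cancel, φ.apply_one])
  obtain ⟨x, hxU, hx⟩ := mem_closure_iff_nhds.1 hy _ hnhds
  obtain ⟨b, hb⟩ := hx (a + 2 * τ)
  have hlast := hb.mul (FlowProduct.single (S := a + τ) (a := a) le_rfl (by linarith) hxU)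
  rw [← φ.map_add, add_neg_cancel, φ.map_zero_apply, mul_inv_cancel_left] at hlast
  exact ⟨b, hlast⟩

theorem contMDiff_hom (φ : AutomorphismFlow I G) (t : ℝ) : ContMDiff I I 1 (φ.hom t) :=
  (φ.contMDiff' t).of_le (by simp)

variable [LieGroup I ∞ G] [I.Boundaryless] [CompleteSpace E] {D : E →L[ℝ] E}

theorem IsAssociatedDerivation.map_lieExp (hD : φ.IsAssociatedDerivation D) (t : ℝ) (X : E) :
    φ t (lieExp I X) = lieExp I (NormedSpace.exp (t • D) X) := by
  rw [← hD t]
  exact _root_.map_lieExp (φ.hom t) (φ.contMDiff_hom t) X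

theorem IsAssociatedDerivation.exp_apply_mem_lieSubmodule (hD : φ.IsAssociatedDerivation D)
    {A : Subgroup G} {hA : IsClosed (A : Set G)} (hφA : ∀ t, A ≤ A.comap (φ.hom t)) {X : E}
    (hX : X ∈ lieSubmodule I A hA) (t : ℝ) :
    NormedSpace.exp (t • D) X ∈ lieSubmodule I A hA := by
  rw [← hD t]
  exact map_derivAtOne_mem_lieSubmodule (φ.hom t) (φ.contMDiff_hom t) (hφA t) hX

variable [IsTopologicalGroup G] {A B : Subgroup G} [B.Normal] {hA : IsClosed (A : Set G)}

theorem IsAssociatedDerivation.exists_flowProduct_mk_eq_lieExp_sum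
    (hD : φ.IsAssociatedDerivation D) (hB : IsClosed (B : Set G)) (hAB : ⁅A, A⁆ ≤ B)
    (hφA : ∀ t, A ≤ A.comap (φ.hom t)) {X : E} (hX : X ∈ lieSubmodule I A hA)
    (hU : (1 : G) ∈ U) {c : ℕ → ℝ} {m : ℕ} (hc : ∀ k < m, lieExp I (c k • X) ∈ U)
    {a q : ℝ} (haq : a + 2 * τ ≤ q / 2) (hτq : τ ≤ q / 2) :
    ∃ w, φ.FlowProduct U τ a (m * q + q / 2) w ∧ (w : G ⧸ B) =
      (lieExp I (∑ k ∈ Finset.range m, c k • NormedSpace.exp (((k + 1) * q) • D) X) : G) := by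
  induction m with
  | zero => exact ⟨1, .one hU (by simpa using haq), by simp [lieExp_zero]⟩
  | succ m ih =>
    obtain ⟨w, hw, hwB⟩ := ih fun k hk ↦ hc k (hk.trans m.lt_succ_self)
    have hmem (k : ℕ) : c k • NormedSpace.exp (((k + 1) * q) • D) X ∈ lieSubmodule I A hA :=
      Submodule.smul_mem _ _ (hD.exp_apply_mem_lieSubmodule hφA hX _)
    have hfactor : φ.FlowProduct U τ (m * q + q / 2) ((m + 1 : ℕ) * q + q / 2)
        (φ ((m + 1) * q) (lieExp I (c m • X))) :=
      .single (by linarith) (by push_cast; linarith) (hc m m.lt_succ_self)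
    refine ⟨_, hfactor.mul hw, ?_⟩
    rw [QuotientGroup.mk_mul, hwB, hD.map_lieExp, map_smul, Finset.sum_range_succ,
      add_comm (Finset.sum _ _),
      mk_lieExp_add hB hAB (hmem m) (Submodule.sum_mem _ fun k _ ↦ hmem k)]

theorem IsAssociatedDerivation.exists_flowProduct_mk_eq_lieExp
    (hD : φ.IsAssociatedDerivation D) (hB : IsClosed (B : Set G)) (hAB : ⁅A, A⁆ ≤ B)
    (hφA : ∀ t, A ≤ A.comap (φ.hom t)) {X : E} (hX : X ∈ lieSubmodule I A hA)
    (hU : (1 : G) ∈ U) {c : ℕ → ℝ} {m : ℕ} (hc : ∀ k < m, lieExp I (c k • X) ∈ U)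
    (hsum : ∀ q : ℝ, ∑ k ∈ Finset.range m, c k • NormedSpace.exp (((k + 1) * q) • D) = 1)
    (a : ℝ) : ∃ b w, φ.FlowProduct U τ a b w ∧ (w : G ⧸ B) = (lieExp I X : G) := by
  obtain ⟨w, hw, hwB⟩ := hD.exists_flowProduct_mk_eq_lieExp_sum (a := a) (τ := τ)
    (q := 2 * max (a + 2 * τ) τ) hB hAB hφA hX hU hc
    (by linarith [le_max_left (a + 2 * τ) τ]) (by linarith [le_max_right (a + 2 * τ) τ])
  have hsumX := congrArg (fun L : E →L[ℝ] E ↦ L X) (hsum (2 * max (a + 2 * τ) τ))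
  simp only [sum_apply, smul_apply, one_apply_eq_self] at hsumX
  exact ⟨_, w, hw, by rw [hwB, hsumX]⟩

theorem IsAssociatedDerivation.lieExp_mem_lateProducts
    (hD : φ.IsAssociatedDerivation D) (hnil : IsNilpotent D) (hB : IsClosed (B : Set G))
    (hAB : ⁅A, A⁆ ≤ B) (hφA : ∀ t, A ≤ A.comap (φ.hom t)) (hU : U ∈ 𝓝 (1 : G))
    (hBU : B.toSubmonoid ≤ φ.lateProducts (mem_of_mem_nhds hU) τ) {X : E}
    (hX : X ∈ lieSubmodule I A hA) :
    lieExp I X ∈ φ.lateProducts (mem_of_mem_nhds hU) τ := by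
  obtain ⟨m, hm⟩ := hnil
  obtain ⟨c, hsum⟩ := exists_sum_smul_exp_eq_one hm
  have hsmall (k : ℕ) : ∀ᶠ n : ℕ in Filter.atTop, lieExp I (c k • (n : ℝ)⁻¹ • X) ∈ U := by
    simp only [smul_comm (c k)]
    exact ((tendsto_lieExp_smul (c k • X)).comp tendsto_inv_atTop_nhds_zero_nat) hU
  obtain ⟨n, hn, hn0⟩ := (((Finset.range m).eventually_all.2 fun k _ ↦ hsmall k).and
    (Filter.eventually_ne_atTop 0)).exists
  rw [← smul_inv_smul₀ (Nat.cast_ne_zero (R := ℝ).2 hn0) X, lieExp_natCast_smul]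
  refine pow_mem (fun a ↦ ?_) n
  obtain ⟨b, w, hw, hwB⟩ := hD.exists_flowProduct_mk_eq_lieExp (τ := τ) hB hAB hφA
    (Submodule.smul_mem _ (n : ℝ)⁻¹ hX) (mem_of_mem_nhds hU)
    (fun k hk ↦ hn k (Finset.mem_range.2 hk)) hsum a
  obtain ⟨b', hb'⟩ := hBU (QuotientGroup.eq_iff_div_mem.1 hwB.symm) b
  exact ⟨b', by simpa only [div_mul_cancel] using hb'.mul hw⟩

theorem IsAssociatedDerivation.toSubmonoid_le_lateProducts
    (hD : φ.IsAssociatedDerivation D) (hnil : IsNilpotent D) (hB : IsClosed (B : Set G))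
    (hAB : ⁅A, A⁆ ≤ B) (hφA : ∀ t, A ≤ A.comap (φ.hom t))
    (hgen : A ≤ (expSubgroup I A hA).topologicalClosure) (hU : U ∈ 𝓝 (1 : G))
    (hBU : B.toSubmonoid ≤ φ.lateProducts (mem_of_mem_nhds hU) τ) :
    A.toSubmonoid ≤ φ.lateProducts (mem_of_mem_nhds hU) τ := by
  have hexp : (expSubgroup I A hA).toSubmonoid ≤ φ.lateProducts (mem_of_mem_nhds hU) τ := by
    rw [expSubgroup, Subgroup.closure_toSubmonoid, Submonoid.closure_le]
    rintro g (⟨X, hX, rfl⟩ | ⟨X, hX, hXg⟩)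
    · exact hD.lieExp_mem_lateProducts hnil hB hAB hφA hU hBU hX
    · rw [← inv_inv g, ← hXg, ← lieExp_neg]
      exact hD.lieExp_mem_lateProducts hnil hB hAB hφA hU hBU (neg_mem hX)
  exact fun g hg ↦ closure_minimal hexp (isClosed_lateProducts hU) (hgen hg)

end FlowProducts

end AutomorphismFlow

namespace AutomorphismFlow

section Chains

variable {E : Type*} [NormedAddCommGroup E] [NormedSpace ℝ E]
  {H : Type*} [TopologicalSpace H] {I : ModelWithCorners ℝ E H}
  {G : Type*} [TopologicalSpace G] [ChartedSpace H G] [Group G]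
  {φ : AutomorphismFlow I G} {U : Set G} {τ : ℝ}

theorem ExistsChain.single {T : ℝ} {x y : G} (hT : τ ≤ T) (hU : y⁻¹ * φ T x ∈ U) :
    φ.ExistsChain U τ x y :=
  ⟨1, fun i ↦ if i = 0 then x else y, fun _ ↦ T, le_rfl, rfl, rfl, fun i hi ↦ by
    obtain rfl := Nat.lt_one_iff.1 hi
    exact ⟨hT, hU⟩⟩

theorem ExistsChain.trans {x y z : G} (hxy : φ.ExistsChain U τ x y)
    (hyz : φ.ExistsChain U τ y z) : φ.ExistsChain U τ x z := by
  obtain ⟨m, p, S, hm, hp0, hpm, hp⟩ := hxy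
  obtain ⟨n, q, T, hn, hq0, hqn, hq⟩ := hyz
  refine ⟨m + n, fun i ↦ if i < m then p i else q (i - m), fun i ↦ if i < m then S i else T (i - m),
    by omega, by simp [hp0, Nat.pos_of_ne_zero (Nat.one_le_iff_ne_zero.1 hm)], by simp [hqn],
    fun i hi ↦ ?_⟩
  rcases lt_trichotomy (i + 1) m with him | rfl | him
  · simpa [him, (Nat.lt_succ_self i).trans him] using hp i (by omega)
  · simpa [hq0, hpm] using hp i (by omega)
  · have hsub : i + 1 - m = i - m + 1 := by omega
    simpa [him.le, not_lt.2 him.le, not_lt.2 (Nat.le_of_lt_succ him), hsub] using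
      hq (i - m) (by omega)

/-- The chain follows the flow for time `b - a` and, for each factor `φ_S(u)` of `g`, jumps by `u`
at time `b - S`; this jump has become `φ_{S - a}(u)` at the end. -/
theorem FlowProduct.existsChain (hU : (1 : G) ∈ U) {a b : ℝ} {g : G}
    (hg : φ.FlowProduct U⁻¹ τ a b g) (x : G) :
    φ.ExistsChain U τ x (φ (b - a) x * φ (-a) g) := by
  induction hg generalizing x with
  | @single a b S u ha hb hu =>
    refine (ExistsChain.single (T := b - S) (y := φ (b - S) x * u) (by linarith) ?_).trans
      (.single (T := S - a) (by linarith) ?_)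
    · simpa [mul_assoc] using hu
    · rw [φ.map_mul', ← φ.map_add, ← φ.map_add]
      simpa [show S - a + (b - S) = b - a by ring, show -a + S = S - a by ring] using hU
  | @mul a b c g h _ _ ihg ihh =>
    have hchain := (ihg x).trans (ihh _)
    rwa [φ.map_mul', ← φ.map_add, ← φ.map_add, show b - a + (c - b) = c - a by ring,
      show b - a + -b = -a by ring, mul_assoc, ← φ.map_mul'] at hchain

theorem FlowProduct.existsChain_of_reverse (hU : (1 : G) ∈ U) {a b : ℝ} {g : G}
    (hg : φ.reverse.FlowProduct U τ a b g) (x : G) :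
    φ.ExistsChain U τ (φ (a - b) x * φ a g) x := by
  induction hg generalizing x with
  | @single a b S u ha hb hu =>
    refine (ExistsChain.single (T := S - a) (y := φ (S - b) x) (by linarith) ?_).trans
      (.single (T := b - S) (by linarith) ?_)
    · change _ * φ (S - a) (φ (a - b) x * φ a (φ (-S) u)) ∈ U
      rw [φ.map_mul', ← φ.map_add, ← φ.map_add, ← φ.map_add]
      simpa [show S - a + (a - b) = S - b by ring, show S - a + (a + -S) = 0 by ring] using hu
    · rw [← φ.map_add]
      simpa using hU
  | @mul a b c g h _ _ ihg ihh =>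
    have hchain := (ihh _).trans (ihg x)
    rwa [φ.map_mul', ← φ.map_add, ← φ.map_add, show a - b + (b - c) = a - c by ring,
      sub_add_cancel, mul_assoc, ← φ.map_mul'] at hchain

variable [FiniteDimensional ℝ E] [I.Boundaryless] [LieGroup I ∞ G] [ConnectedSpace G]
  [Group.IsSolvable G]

theorem IsNilpotentFlow.lateProducts_eq_top (hφ : φ.IsNilpotentFlow) (hU : U ∈ 𝓝 (1 : G))
    (τ : ℝ) : φ.lateProducts (mem_of_mem_nhds hU) τ = ⊤ := by
  have := topologicalGroup_of_lieGroup I ∞ (G := G)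
  have := I.t1Space G
  have := FiniteDimensional.complete ℝ E
  obtain ⟨D, hD, hnil⟩ := hφ
  obtain ⟨n, hn⟩ := exists_closedDerivedSeries_eq_bot (G := G)
  refine top_le_iff.1 (Nat.decreasingInduction (n := n)
    (motive := fun k _ ↦ (closedDerivedSeries G k).toSubmonoid ≤ φ.lateProducts _ τ)
    (fun k _ ih ↦ ?_) (by rw [hn]; exact bot_le) n.zero_le)
  exact hD.toSubmonoid_le_lateProducts hnil (isClosed_closedDerivedSeries G (k + 1))
    (Subgroup.le_topologicalClosure _)
    (fun t ↦ closedDerivedSeries_le_comap (φ.contMDiff_hom t).continuous k)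
    (closedDerivedSeries_le_topologicalClosure_expSubgroup I k) hU ih

theorem IsNilpotentFlow.existsChain (hφ : φ.IsNilpotentFlow) (hU : U ∈ 𝓝 (1 : G)) (τ : ℝ)
    (x y : G) : φ.ExistsChain U τ x y := by
  have := topologicalGroup_of_lieGroup I ∞ (G := G)
  have hU_inv : U⁻¹ ∈ 𝓝 (1 : G) := inv_mem_nhds_one G hU
  obtain ⟨s, hx⟩ := (hφ.reverse.lateProducts_eq_top hU τ).ge (Submonoid.mem_top x) 0
  obtain ⟨t, hy⟩ := (hφ.lateProducts_eq_top hU_inv τ).ge (Submonoid.mem_top y) 0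
  have hx1 := hx.existsChain_of_reverse (mem_of_mem_nhds hU) 1
  have h1y := hy.existsChain (mem_of_mem_nhds hU) 1
  simp only [φ.apply_one, one_mul, φ.map_zero_apply, neg_zero] at hx1 h1y
  exact hx1.trans h1y

end Chains

end AutomorphismFlow

theorem proposition4p2
    {E : Type*} [NormedAddCommGroup E] [NormedSpace ℝ E] [FiniteDimensional ℝ E]
    {H : Type*} [TopologicalSpace H] (I : ModelWithCorners ℝ E H) [I.Boundaryless]
    {G : Type*} [TopologicalSpace G] [ChartedSpace H G] [Group G] [LieGroup I ∞ G]
    [ConnectedSpace G] [Group.IsSolvable G]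
    (φ : AutomorphismFlow I G) (hφ : φ.IsNilpotentFlow) :
    φ.IsChainTransitive := by
  have hΩ (x y : G) : y ∈ φ.chainLimitSet x := fun _ hU τ _ ↦ hφ.existsChain hU τ x y
  exact ⟨1, hΩ 1 1, fun y _ ↦ ⟨hΩ y y, hΩ y 1, hΩ 1 y⟩⟩
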